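/- Let $(\Omega,\mathcal F,\mathbb P)$ be a probability space with a right-continuous filtration $(\mathcal F_t)_{t\ge 0}$ (not necessarily augmented by null sets), and let $\mathcal F_\infty=\bigvee_{t\ge 0}\mathcal F_t$. Let $X=(X_t)_{t\ge 0}$ be an adapted $\mathbb R^d$-valued process all of whose paths are càdlàg. A process $Y$ with values in a metric space is called globally sticky if $\mathbb P\big(\sup_{t\in[\tau,\infty)} d(Y_t,Y_\tau)\le\varepsilon \,\big|\, \mathcal F_\tau\big)>0$ almost surely for every stopping time $\tau:\Omega\to[0,\infty]$ and every strictly positive $\mathcal F_\tau$-measurable real random variable $\varepsilon$ (on $\{\tau=\infty\}$ the supremum is over the empty set and equals $-\infty$). $X$ is called sticky if the stopped process $(X_{t\wedge T})_{t\ge0}$ is globally sticky for every $T\in[0,\infty)$. Let $\mathrm{CO}(\mathbb R^d)$ be the complete lattice of all closed convex subsets of $\mathbb R^d$ (including $\emptyset$), ordered by inclusion, with infima given by intersections and suprema by closed convex hulls of unions. It is equipped with the Borel $\sigma$-algebra of the extended Wijsman topology, that is, of the coarsest topology for which all the maps $C\mapsto d(x,C)\in[0,\infty]$, $x\in\mathbb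 R^d$, are continuous, where $d(x,\emptyset)=\infty$. For a random element $V$ of $\mathrm{CO}(\mathbb R^d)$ and a sub-$\sigma$-algebra $\mathcal E\subseteq\mathcal F$, the conditional infimum $\bigwedge[V\mid\mathcal E]$ is the almost surely unique $\mathcal E$-measurable random element of $\mathrm{CO}(\mathbb R^d)$ with $\bigwedge[V\mid\mathcal E]\le V$ almost surely and $Z\le\bigwedge[V\mid\mathcal E]$ almost surely for every $\mathcal E$-measurable random element $Z$ with $Z\le V$ almost surely. Define $U_t=\overline{\mathrm{conv}}(X_s\colon s\le t)$, the closed convex hull of the path of $X$ up to time $t$. If $X$ is sticky, then the $\mathrm{CO}(\mathbb R^d)$-valued process $U=(U_t)_{t\ge0}$ is adapted, and $$U_t=\bigwedge[U_T\mid\mathcal F_t]\quad\text{almost surely, for all } 0\le t\le T<\infty.$$ -/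

import Mathlib

open MeasureTheory Filter Topology
open scoped NNReal ENNReal

/-- `ClosedConvex d` is the collection `CO(ℝ^d)` of all closed convex subsets of the Euclidean
space `ℝ^d`, the empty set included. -/
@[ext]
structure ClosedConvex (d : ℕ) where
  /-- The underlying set. -/
  carrier : Set (EuclideanSpace ℝ (Fin d))
  convex : Convex ℝ carrier
  isClosed : IsClosed carrier

namespace ClosedConvex

variable {d : ℕ}

/-- `CO(ℝ^d)` is ordered by inclusion. -/
instance : PartialOrder (ClosedConvex d) :=
  PartialOrder.lift carrier fun _ _ h => ClosedConvex.ext h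

/-- The closed convex hull `cl conv A` of a set `A`, as an element of `CO(ℝ^d)`. -/
def hull (A : Set (EuclideanSpace ℝ (Fin d))) : ClosedConvex d where
  carrier := closedConvexHull ℝ A
  convex := convex_closedConvexHull
  isClosed := isClosed_closedConvexHull

/-- The infimum of a family of closed convex sets is its intersection. -/
instance : InfSet (ClosedConvex d) where
  sInf S :=
    { carrier := ⋂ C ∈ S, C.carrier
      convex := convex_iInter₂ fun C _ => C.convex
      isClosed := isClosed_biInter fun C _ => C.isClosed }

/-- The supremum of a family of closed convex sets is the closed convex hull of its union. -/
instance : SupSet (ClosedConvex d) where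
  sSup S := hull (⋃ C ∈ S, C.carrier)

theorem isGLB_sInf' (S : Set (ClosedConvex d)) : IsGLB S (sInf S) :=
  ⟨fun _ hC => Set.biInter_subset_of_mem hC, fun _ hB => Set.subset_iInter₂ fun _ hC => hB hC⟩

theorem isLUB_sSup' (S : Set (ClosedConvex d)) : IsLUB S (sSup S) :=
  ⟨fun _ hC => (Set.subset_biUnion_of_mem hC).trans subset_closedConvexHull,
    fun B hB => closedConvexHull_min (Set.iUnion₂_subset fun _ hC => hB hC) B.convex B.isClosed⟩

/-- The complete lattice `CO(ℝ^d)`. -/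
instance : CompleteLattice (ClosedConvex d) where
  __ := completeLatticeOfInf (ClosedConvex d) isGLB_sInf'
  sSup := sSup
  isLUB_sSup := isLUB_sSup'

/-- The (extended) Wijsman topology: the coarsest topology for which all the distance functions
`C ↦ d(x, C)` are continuous. Here `d(x, ∅) = ∞`, so that `Cₙ → ∅` means that `d(x, Cₙ) → ∞` for
every `x`, while on nonempty sets the distances are finite. -/
noncomputable instance : TopologicalSpace (ClosedConvex d) :=
  ⨅ x : EuclideanSpace ℝ (Fin d),
    TopologicalSpace.induced (fun C : ClosedConvex d => Metric.infEDist x C.carrier) inferInstance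

/-- `CO(ℝ^d)` carries the Borel σ-algebra of the Wijsman topology. -/
noncomputable instance : MeasurableSpace (ClosedConvex d) := borel _

instance : BorelSpace (ClosedConvex d) := ⟨rfl⟩

end ClosedConvex

/-- `V` is (a version of) the conditional infimum `⋀[X | 𝓔]`: it is the greatest, up to null sets,
among the `𝓔`-measurable random elements that are almost surely below `X`. -/
structure IsCondInf {Ω S : Type*} [MeasurableSpace Ω] [CompleteLattice S] [MeasurableSpace S]
    (P : Measure Ω) (𝓔 : MeasurableSpace Ω) (X V : Ω → S) : Prop where
  measurable : Measurable[𝓔] V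
  le : V ≤ᵐ[P] X
  greatest : ∀ Z : Ω → S, Measurable[𝓔] Z → Z ≤ᵐ[P] X → Z ≤ᵐ[P] V

/-- All paths are right-continuous with left limits. -/
def IsCadlagProcess {Ω E : Type*} [TopologicalSpace E] (X : ℝ≥0 → Ω → E) : Prop :=
  ∀ ω t, ContinuousWithinAt (fun s => X s ω) (Set.Ici t) t ∧
    ∃ l, Tendsto (fun s => X s ω) (𝓝[<] t) (𝓝 l)

/-- The event `sup_{t ∈ [τ, ∞)} d(X_t, X_τ) ≤ ε`; it contains `{τ = ∞}`. -/
def stayEvent {Ω E : Type*} [PseudoMetricSpace E] (X : ℝ≥0 → Ω → E)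
    (τ : Ω → WithTop ℝ≥0) (ε : Ω → ℝ) : Set Ω :=
  {ω | ∀ s t : ℝ≥0, τ ω = s → s ≤ t → dist (X t ω) (X s ω) ≤ ε ω}

/-- Global stickiness: `P(sup_{t ∈ [τ, ∞)} d(X_t, X_τ) ≤ ε | 𝓕_τ) > 0` almost surely, for every
stopping time `τ` and every strictly positive `𝓕_τ`-measurable random variable `ε`. -/
def IsGloballySticky {Ω E : Type*} [mΩ : MeasurableSpace Ω] [PseudoMetricSpace E]
    (P : Measure Ω) (𝓕 : Filtration ℝ≥0 mΩ) (X : ℝ≥0 → Ω → E) : Prop :=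
  ∀ (τ : Ω → WithTop ℝ≥0) (hτ : IsStoppingTime 𝓕 τ) (ε : Ω → ℝ),
    Measurable[hτ.measurableSpace] ε → (∀ ω, 0 < ε ω) →
      ∀ᵐ ω ∂P, 0 < (P[(stayEvent X τ ε).indicator (fun _ => (1 : ℝ)) | hτ.measurableSpace]) ω

/-- Stickiness: for every deterministic time `T`, the stopped process `X^T = (X_{t ∧ T})` is
globally sticky. -/
def IsSticky {Ω E : Type*} [mΩ : MeasurableSpace Ω] [PseudoMetricSpace E]
    (P : Measure Ω) (𝓕 : Filtration ℝ≥0 mΩ) (X : ℝ≥0 → Ω → E) : Prop :=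
  ∀ T : ℝ≥0, IsGloballySticky P 𝓕 (fun t => X (min t T))

/-- The process of closed convex hulls `U_t = cl conv(X_s : s ≤ t)`. -/
def hullProcess {Ω : Type*} {d : ℕ} (X : ℝ≥0 → Ω → EuclideanSpace ℝ (Fin d)) :
    ℝ≥0 → Ω → ClosedConvex d :=
  fun t ω => ClosedConvex.hull ((fun s => X s ω) '' Set.Iic t)

namespace ClosedConvex

variable {d : ℕ}

/-! The hulls increase, so only maximality needs stickiness. Let `Z` be `𝓕 t`-measurable with `Z ≤
U_T` almost surely. Given `𝓕 t`, the path stays within `ε` of `X_t` on `[t, T]` with positive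
conditional probability, and then `U_T` lies in the closed `ε`-thickening of `U_t`, which is again
closed and convex. Hence so does `Z`. But this last inclusion is an `𝓕 t`-measurable event, so it is
almost sure (`ae_mem_of_condExp_indicator_pos`). Letting `ε → 0` along `1/(n+1)` gives `Z ≤ U_t`,
because `U_t` is closed.

Measurability reduces to distance functions (`measurable_of_infEDist`). -/

theorem continuous_infEDist_carrier (x : EuclideanSpace ℝ (Fin d)) :
    Continuous fun C : ClosedConvex d => Metric.infEDist x C.carrier :=
  continuous_iff_le_induced.2 (iInf_le _ x)

theorem measurable_infEDist_carrier (x : EuclideanSpace ℝ (Fin d)) :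
    Measurable fun C : ClosedConvex d => Metric.infEDist x C.carrier :=
  (continuous_infEDist_carrier x).measurable

/-- A topology making the distances to the points of a dense sequence continuous makes all the
distance functions continuous. -/
theorem continuous_infEDist_of_dense {α E : Type*} [PseudoMetricSpace E] [TopologicalSpace α]
    (K : α → Set E) {u : ℕ → E} (hu : DenseRange u)
    (h : ∀ n, Continuous fun a => Metric.infEDist (u n) (K a)) (x : E) :
    Continuous fun a => Metric.infEDist x (K a) := by
  rw [continuous_iff_lower_upperSemicontinuous]
  have hx : ∀ δ : ℝ≥0∞, 0 < δ → ∃ n, edist x (u n) < δ := fun δ hδ => by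
    obtain ⟨_, ⟨n, rfl⟩, hy⟩ := EMetric.mem_closure_iff.1 (hu x) δ hδ
    exact ⟨n, hy⟩
  constructor
  -- Distances are 1-Lipschitz in the point, so they are suprema, and below infima, of continuous
  -- functions. This gives both semicontinuities, infinite values included.
  · have : (fun a => Metric.infEDist x (K a)) =
        fun a => ⨆ n, (Metric.infEDist (u n) (K a) - edist (u n) x) := by
      funext a
      refine le_antisymm (ENNReal.le_of_forall_pos_le_add fun δ hδ _ => ?_)
        (iSup_le fun n => tsub_le_iff_right.2 Metric.infEDist_le_infEDist_add_edist)
      obtain ⟨n, hn⟩ := hx (δ / 2) (ENNReal.half_pos (ENNReal.coe_pos.2 hδ).ne')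
      calc Metric.infEDist x (K a) ≤ Metric.infEDist (u n) (K a) + edist x (u n) :=
            Metric.infEDist_le_infEDist_add_edist
        _ ≤ (Metric.infEDist (u n) (K a) - edist (u n) x + edist (u n) x) + edist x (u n) := by
            gcongr; exact le_tsub_add
        _ ≤ (⨆ n, (Metric.infEDist (u n) (K a) - edist (u n) x)) + (δ / 2 + δ / 2) := by
            rw [add_assoc, edist_comm (u n) x]
            gcongr
            rw [edist_comm x (u n)]
            exact le_iSup (fun n => Metric.infEDist (u n) (K a) - edist (u n) x) n
        _ = _ := by rw [ENNReal.add_halves]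
    rw [this]
    refine lowerSemicontinuous_iSup fun n => Continuous.lowerSemicontinuous ?_
    exact (ENNReal.continuous_sub_right _).comp (h n)
  · have : (fun a => Metric.infEDist x (K a)) =
        fun a => ⨅ n, (Metric.infEDist (u n) (K a) + edist x (u n)) := by
      funext a
      refine le_antisymm (le_iInf fun n => Metric.infEDist_le_infEDist_add_edist)
        (ENNReal.le_of_forall_pos_le_add fun δ hδ _ => ?_)
      obtain ⟨n, hn⟩ := hx (δ / 2) (ENNReal.half_pos (ENNReal.coe_pos.2 hδ).ne')
      calc (⨅ n, (Metric.infEDist (u n) (K a) + edist x (u n)))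
          ≤ Metric.infEDist (u n) (K a) + edist x (u n) := iInf_le _ n
        _ ≤ (Metric.infEDist x (K a) + edist (u n) x) + edist x (u n) := by
            gcongr; exact Metric.infEDist_le_infEDist_add_edist
        _ ≤ Metric.infEDist x (K a) + (δ / 2 + δ / 2) := by
            rw [add_assoc, edist_comm (u n) x]
            gcongr
        _ = _ := by rw [ENNReal.add_halves]
    rw [this]
    exact upperSemicontinuous_iInf fun n =>
      ((h n).add continuous_const).upperSemicontinuous

/-- The Wijsman topology is induced by countably many distance functions. -/
theorem topology_eq_induced {u : ℕ → EuclideanSpace ℝ (Fin d)} (hu : DenseRange u) :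
    (inferInstance : TopologicalSpace (ClosedConvex d)) =
      TopologicalSpace.induced (fun C n => Metric.infEDist (u n) C.carrier) inferInstance := by
  refine le_antisymm
    (continuous_iff_le_induced.1 (continuous_pi fun n => continuous_infEDist_carrier (u n)))
    (le_iInf fun x => continuous_iff_le_induced.1 ?_)
  -- Shadows the Wijsman instance: continuity below refers to the induced topology.
  let : TopologicalSpace (ClosedConvex d) :=
    TopologicalSpace.induced (fun C n => Metric.infEDist (u n) C.carrier) inferInstance
  exact continuous_infEDist_of_dense carrier hu
    (fun n => (continuous_apply n).comp continuous_induced_dom) x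

/-- The Borel σ-algebra of the Wijsman topology is generated by the distance functions. -/
theorem measurable_of_infEDist {Ω : Type*} {m : MeasurableSpace Ω} {V : Ω → ClosedConvex d}
    (hV : ∀ x, Measurable fun ω => Metric.infEDist x (V ω).carrier) : Measurable V := by
  have hu := TopologicalSpace.denseRange_denseSeq (EuclideanSpace ℝ (Fin d))
  have h : (instMeasurableSpace : MeasurableSpace (ClosedConvex d)) =
      MeasurableSpace.comap (fun C n => Metric.infEDist
        (TopologicalSpace.denseSeq (EuclideanSpace ℝ (Fin d)) n) C.carrier) MeasurableSpace.pi := by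
    refine (congrArg (@borel _) (topology_eq_induced hu)).trans ?_
    -- Countability of the index set matters here: the product σ-algebra is then Borel.
    rw [borel_comap, BorelSpace.measurable_eq (α := ℕ → ℝ≥0∞)]
  rw [measurable_iff_comap_le, h, MeasurableSpace.comap_comp, ← measurable_iff_comap_le]
  exact measurable_pi_iff.2 fun n => hV _

end ClosedConvex

/-! ### Adaptedness of the hull process -/

/-- The distance to the convex hull of an indexed family is an infimum over the weights of
finite convex combinations. -/
theorem infEDist_convexHull_range {ι E : Type*} [NormedAddCommGroup E] [NormedSpace ℝ E]
    (f : ι → E) (x : E) :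
    Metric.infEDist x (convexHull ℝ (Set.range f)) =
      ⨅ s : Finset ι, ⨅ w : stdSimplex ℝ s, edist x (∑ i, (w : s → ℝ) i • f i) := by
  refine le_antisymm (le_iInf₂ fun s w => Metric.infEDist_le_edist_of_mem ?_) ?_
  · exact mem_convexHull_of_exists_fintype (w : s → ℝ) (fun i => f i) w.2.1 w.2.2
      (fun i => ⟨i, rfl⟩) rfl
  · refine Metric.le_infEDist.2 fun y hy => ?_
    rw [convexHull_range_eq_exists_affineCombination] at hy
    obtain ⟨s, w, hw₀, hw₁, rfl⟩ := hy
    have hw : (fun i : s => w i) ∈ stdSimplex ℝ s :=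
      ⟨fun i => hw₀ i i.2, (Finset.sum_coe_sort s w).trans hw₁⟩
    refine iInf₂_le_of_le s ⟨_, hw⟩ (le_of_eq ?_)
    rw [Finset.affineCombination_eq_linear_combination _ _ _ hw₁]
    exact congrArg _ (Finset.sum_coe_sort s fun i => w i • f i)

theorem measurable_infEDist_convexHull_range {Ω ι E : Type*} [MeasurableSpace Ω] [Countable ι]
    [NormedAddCommGroup E] [NormedSpace ℝ E] [SecondCountableTopology E] [MeasurableSpace E]
    [BorelSpace E] {f : ι → Ω → E} (hf : ∀ i, Measurable (f i)) (x : E) :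
    Measurable fun ω => Metric.infEDist x (convexHull ℝ (Set.range fun i => f i ω)) := by
  simp_rw [infEDist_convexHull_range]
  refine Measurable.iInf fun s => ?_
  obtain ⟨D, hDc, hD⟩ := TopologicalSpace.exists_countable_dense (stdSimplex ℝ s)
  have : Countable D := hDc
  -- By continuity in the weights, countably many of them, independent of `ω`, suffice.
  have h (ω : Ω) : ⨅ w : stdSimplex ℝ s, edist x (∑ i, (w : s → ℝ) i • f i ω) =
      ⨅ w : D, edist x (∑ i, (w : s → ℝ) i • f i ω) :=
    (hD.ciInf' (f := fun w : stdSimplex ℝ s => edist x (∑ i, (w : s → ℝ) i • f i ω))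
      (continuous_const.edist (continuous_finsetSum _ fun i _ =>
        ((continuous_apply i).comp continuous_subtype_val).smul continuous_const))).symm
  simp_rw [h]
  exact Measurable.iInf fun w => measurable_const.edist
    (Finset.measurable_sum _ fun i _ => (hf i).const_smul _)

/-- The range of a right-continuous path over `[0, t]` is contained in the closure of its range
over a dense set of times before `t`, together with `t` itself. -/
theorem image_Iic_subset_closure {E : Type*} [TopologicalSpace E] {x : ℝ≥0 → E}
    (hx : ∀ s, ContinuousWithinAt x (Set.Ici s) s) {D : Set ℝ≥0} (hD : Dense D) (t : ℝ≥0) :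
    x '' Set.Iic t ⊆ closure (x '' (insert t (Set.Iio t ∩ D))) := by
  rintro _ ⟨s, hs, rfl⟩
  obtain rfl | hst := eq_or_lt_of_le (Set.mem_Iic.1 hs)
  · exact subset_closure ⟨s, Set.mem_insert .., rfl⟩
  · have hcl : s ∈ closure (Set.Ioo s t ∩ D) := by
      have h := closure_mono (hD.open_subset_closure_inter (isOpen_Ioo (a := s) (b := t)))
      rw [closure_closure, closure_Ioo hst.ne] at h
      exact h (Set.left_mem_Icc.2 hst.le)
    have h := ((hx s).mono (s := Set.Ioo s t ∩ D) fun r hr => hr.1.1.le).mem_closure_image hcl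
    have hsub : Set.Ioo s t ∩ D ⊆ insert t (Set.Iio t ∩ D) :=
      fun r hr => Or.inr ⟨hr.1.2, hr.2⟩
    exact closure_mono (Set.image_mono hsub) h

theorem adapted_hullProcess {Ω : Type*} [mΩ : MeasurableSpace Ω] {𝓕 : Filtration ℝ≥0 mΩ} {d : ℕ}
    {X : ℝ≥0 → Ω → EuclideanSpace ℝ (Fin d)} (hX : Adapted 𝓕 X)
    (hXr : ∀ ω s, ContinuousWithinAt (fun r => X r ω) (Set.Ici s) s) :
    Adapted 𝓕 (hullProcess X) := by
  intro t
  obtain ⟨D, hDc, hD⟩ := TopologicalSpace.exists_countable_dense ℝ≥0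
  -- The endpoint `t` is added because right-continuity cannot recover `X_t` from earlier times.
  set S : Set ℝ≥0 := insert t (Set.Iio t ∩ D) with hS
  have hSc : Countable S := ((hDc.mono Set.inter_subset_right).insert t).to_subtype
  have hSt : S ⊆ Set.Iic t := Set.insert_subset Set.self_mem_Iic
    (Set.inter_subset_left.trans Set.Iio_subset_Iic_self)
  have hcarrier (ω : Ω) : (hullProcess X t ω).carrier =
      closure (convexHull ℝ (Set.range fun s : S => X s ω)) := by
    rw [← closedConvexHull_eq_closure_convexHull]
    have hr : Set.range (fun s : S => X s ω) = (fun s => X s ω) '' S := by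
      rw [Set.image_eq_range]
    rw [hr]
    refine subset_antisymm ?_ ((closedConvexHull ℝ).monotone (Set.image_mono hSt))
    exact closedConvexHull_min ((image_Iic_subset_closure (hXr ω) hD t).trans
      (closure_minimal subset_closedConvexHull isClosed_closedConvexHull))
      convex_closedConvexHull isClosed_closedConvexHull
  refine ClosedConvex.measurable_of_infEDist fun x => ?_
  simp_rw [hcarrier, Metric.infEDist_closure]
  have hXm (s : S) : Measurable[𝓕 t] (X s) := (hX s).mono (𝓕.mono (hSt s.2)) le_rfl
  exact @measurable_infEDist_convexHull_range Ω S _ (𝓕 t) _ _ _ _ _ _ _ hXm x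

theorem hullProcess_mono {Ω : Type*} {d : ℕ} (X : ℝ≥0 → Ω → EuclideanSpace ℝ (Fin d))
    {t T : ℝ≥0} (h : t ≤ T) : hullProcess X t ≤ hullProcess X T := fun _ =>
  (closedConvexHull ℝ).monotone (Set.image_mono (Set.Iic_subset_Iic.2 h))

/-! ### Thickenings and conditional positivity -/

/-- A path that stays within `ε` of its value at time `t` enlarges its closed convex hull by at
most `ε` after time `t`. -/
theorem hullProcess_subset_cthickening {Ω : Type*} {d : ℕ}
    {X : ℝ≥0 → Ω → EuclideanSpace ℝ (Fin d)} {t T : ℝ≥0} {ω : Ω} {ε : ℝ}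
    (h : ∀ s, t ≤ s → s ≤ T → dist (X s ω) (X t ω) ≤ ε) :
    (hullProcess X T ω).carrier ⊆ Metric.cthickening ε (hullProcess X t ω).carrier := by
  refine closedConvexHull_min ?_ ((hullProcess X t ω).convex.cthickening ε)
    Metric.isClosed_cthickening
  rintro _ ⟨s, hs, rfl⟩
  have hmem {r : ℝ≥0} (hr : r ≤ t) : X r ω ∈ (hullProcess X t ω).carrier :=
    subset_closedConvexHull ⟨r, hr, rfl⟩
  obtain hst | hts := le_total s t
  · exact Metric.self_subset_cthickening _ (hmem hst)
  · exact Metric.mem_cthickening_of_dist_le _ _ _ _ (hmem le_rfl) (h s hts hs)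

/-- Inclusion in a closed thickening is a condition on the distances to a dense set of points. -/
theorem subset_cthickening_iff_of_denseRange {E : Type*} [PseudoMetricSpace E] {u : ℕ → E}
    (hu : DenseRange u) {A B : Set E} {ε : ℝ} :
    A ⊆ Metric.cthickening ε B ↔
      ∀ n, Metric.infEDist (u n) B ≤ Metric.infEDist (u n) A + ENNReal.ofReal ε := by
  constructor
  · exact fun h n => Metric.infEDist_le_infEDist_cthickening_add.trans
      (by gcongr)
  · intro h x hx
    have hclosed : IsClosed {y | Metric.infEDist y B ≤ Metric.infEDist y A + ENNReal.ofReal ε} :=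
      isClosed_le Metric.continuous_infEDist (Metric.continuous_infEDist.add continuous_const)
    have := hclosed.closure_subset_iff.2 (Set.range_subset_iff.2 h) (hu x)
    simpa [Metric.mem_cthickening_iff, Metric.infEDist_zero_of_mem hx] using this

theorem measurableSet_subset_cthickening {Ω : Type*} [MeasurableSpace Ω] {d : ℕ}
    {Z V : Ω → ClosedConvex d} (hZ : Measurable Z) (hV : Measurable V) (ε : ℝ) :
    MeasurableSet {ω | (Z ω).carrier ⊆ Metric.cthickening ε (V ω).carrier} := by
  simp_rw [subset_cthickening_iff_of_denseRange
    (TopologicalSpace.denseRange_denseSeq (EuclideanSpace ℝ (Fin d))), Set.ofPred_forall]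
  exact MeasurableSet.iInter fun n => measurableSet_le
    ((ClosedConvex.measurable_infEDist_carrier _).comp hV)
    (((ClosedConvex.measurable_infEDist_carrier _).comp hZ).add measurable_const)

/-- An `m`-measurable event that almost surely contains an event of positive conditional
probability given `m` is almost sure. -/
theorem ae_mem_of_condExp_indicator_pos {Ω : Type*} {m mΩ : MeasurableSpace Ω} {P : Measure Ω}
    [IsFiniteMeasure P] (hm : m ≤ mΩ) {A B : Set Ω} (hB : MeasurableSet[m] B)
    (hAB : ∀ᵐ ω ∂P, ω ∈ A → ω ∈ B)
    (hA : ∀ᵐ ω ∂P, 0 < (P[A.indicator (fun _ => (1 : ℝ)) | m]) ω) : ∀ᵐ ω ∂P, ω ∈ B := by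
  by_cases hint : Integrable (A.indicator fun _ => (1 : ℝ)) P
  · have hBint : Integrable (B.indicator fun _ => (1 : ℝ)) P :=
      (integrable_const 1).indicator (hm _ hB)
    have hle : A.indicator (fun _ => (1 : ℝ)) ≤ᵐ[P] B.indicator fun _ => (1 : ℝ) := by
      filter_upwards [hAB] with ω hω
      by_cases hωA : ω ∈ A
      · simp [hωA, hω hωA]
      · simpa [hωA] using Set.indicator_nonneg (fun _ _ => zero_le_one) ω
    have hmono := condExp_mono (m := m) hint hBint hle
    rw [condExp_of_stronglyMeasurable hm (stronglyMeasurable_const.indicator hB) hBint] at hmono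
    filter_upwards [hA, hmono] with ω hpos hω
    by_contra hωB
    simp only [Set.indicator_of_notMem hωB] at hω
    exact absurd hpos hω.not_gt
  -- `A` need not be measurable. If its indicator is not integrable, the conditional expectation is
  -- `0` by default, contradicting positivity.
  · rw [condExp_of_not_integrable hint] at hA
    filter_upwards [hA] with ω hω using absurd hω (lt_irrefl _)

/-- Given the information at time `t`, a sticky process stays with positive conditional
probability within `ε` of its current position up to time `T`. -/
theorem IsSticky.condExp_pos {Ω E : Type*} [mΩ : MeasurableSpace Ω] [PseudoMetricSpace E]
    {P : Measure Ω} {𝓕 : Filtration ℝ≥0 mΩ} {X : ℝ≥0 → Ω → E} (hX : IsSticky P 𝓕 X)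
    {t T : ℝ≥0} (htT : t ≤ T) {ε : ℝ} (hε : 0 < ε) :
    ∀ᵐ ω ∂P, 0 < (P[{ω | ∀ s, t ≤ s → s ≤ T → dist (X s ω) (X t ω) ≤ ε}.indicator
      (fun _ => (1 : ℝ)) | 𝓕 t]) ω := by
  have h := hX T (fun _ => t) (isStoppingTime_const 𝓕 t) (fun _ => ε) measurable_const
    fun _ => hε
  have hset : stayEvent (fun s => X (min s T)) (fun _ => (t : WithTop ℝ≥0)) (fun _ => ε) =
      {ω | ∀ s, t ≤ s → s ≤ T → dist (X s ω) (X t ω) ≤ ε} := by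
    ext ω
    constructor
    · intro h s hts hsT
      simpa [min_eq_left hsT, min_eq_left htT] using h t s rfl hts
    · intro h r s hr hrs
      obtain rfl : t = r := WithTop.coe_injective hr
      simpa [min_eq_left htT] using h (min s T) (le_min hrs htT) (min_le_right _ _)
  rwa [hset, IsStoppingTime.measurableSpace_const] at h

theorem propositionP {Ω : Type*} [mΩ : MeasurableSpace Ω] (P : Measure Ω) [IsProbabilityMeasure P]
    (𝓕 : Filtration ℝ≥0 mΩ) [𝓕.IsRightContinuous] (d : ℕ)
    (X : ℝ≥0 → Ω → EuclideanSpace ℝ (Fin d)) (hXadapted : Adapted 𝓕 X)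
    (hXcadlag : IsCadlagProcess X) (hXsticky : IsSticky P 𝓕 X) :
    Adapted 𝓕 (hullProcess X) ∧
      ∀ t T : ℝ≥0, t ≤ T → IsCondInf P (𝓕 t) (hullProcess X T) (hullProcess X t) := by
  have hadapted := adapted_hullProcess hXadapted fun ω s => (hXcadlag ω s).1
  refine ⟨hadapted, fun t T htT => ⟨hadapted t, .of_forall (hullProcess_mono X htT), ?_⟩⟩
  intro Z hZ hZle
  have hthick (n : ℕ) : ∀ᵐ ω ∂P,
      (Z ω).carrier ⊆ Metric.cthickening (1 / (n + 1 : ℝ)) (hullProcess X t ω).carrier := by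
    refine ae_mem_of_condExp_indicator_pos (𝓕.le t)
      (@measurableSet_subset_cthickening Ω (𝓕 t) d _ _ hZ (hadapted t) _) ?_
      (hXsticky.condExp_pos htT (Nat.one_div_pos_of_nat (n := n)))
    filter_upwards [hZle] with ω hω hstay
    exact Set.Subset.trans hω (hullProcess_subset_cthickening hstay)
  filter_upwards [ae_all_iff.2 hthick] with ω hω x hx
  refine (Metric.mem_iff_infEDist_zero_of_closed (hullProcess X t ω).isClosed).2 ?_
  refine le_antisymm (ge_of_tendsto' (x := atTop) ?_ fun n => hω n hx) zero_le
  simpa using ENNReal.tendsto_ofReal tendsto_one_div_add_atTop_nhds_zero_nat
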